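/- **Proposition 5.1.** Let $n\ge 0$, $\mathbf c\in\mathbb Z_{\ge0}^n$, let $\mathcal C=\{\mathbf x\in\mathbb Z^n:\mathbf 0\le\mathbf x\le\mathbf c\}$ be an integer box, and write $\mathbf 1^j$ for the $j$-th unit vector. Let $$f(\mathbf x)=\sum_{H\in\mathcal H}a_H\prod_{j\in H}f_j^H(x_j)\qquad(\mathbf x\in\mathcal C),$$ where $\mathcal H$ is a finite multiset of subsets of $\{1,\dots,n\}$, $a_H>0$, and each $f_j^H:\{0,\dots,c_j\}\to\mathbb R_{\ge0}$ ($j\in H$) is non-decreasing and discretely convex; here $g:\{0,\dots,c\}\to\mathbb R$ is discretely convex if for all $x,y\in\{0,\dots,c\}$ and $\lambda\in[0,1]$ $$\lambda g(x)+(1-\lambda)g(y)\ \ge\ \min\{g(u):u\in\{0,\dots,c\},\ |\lambda x+(1-\lambda)y-u|\le1\}.$$ Let $R=f(\mathbf c)$, let $t\le R$, and let the traction $\tau$ of $f$ be the minimum of the positive values of $f(\mathbf x+\mathbf 1^j)-f(\mathbf x)$ over all $j$ and all $\mathbf x\in\mathcal C$ with $x_j<c_j$. Let $\mathcal F$ be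 the set of maximal feasible vectors of the inequality $f(\mathbf x)\le t$, i.e. of all $\mathbf x\in\mathcal C$ with $f(\mathbf x)\le t$ and $f(\mathbf x+\mathbf 1^j)>t$ for every $j$ with $x_j<c_j$. For $\mathcal A\subseteq\mathcal C$ let $\mathcal I(\mathcal A)$ be the set of minimal elements of $\{\mathbf x\in\mathcal C:\mathbf x\not\le\mathbf a\text{ for all }\mathbf a\in\mathcal A\}$. Then for every $\mathcal Y\subseteq\mathcal F$ with $|\mathcal Y|\ge2$, $$|\mathcal I(\mathcal Y)\cap\mathcal I(\mathcal F)|\ \le\ |\mathcal Y|^{\,h\left(\frac{R-t}{\tau},\,|\mathcal Y|\right)},$$ where $h:\mathbb R\times\mathbb N\to\mathbb R$ is a universal function (not depending on $n,\mathbf c,f,t,\mathcal Y$) such that $h(s,k)=o(\log s)$ as $s\to\infty$ and $k\to\infty$ (that is, $h(s,k)/\log s\to0$ as $\min(s,k)\to\infty$), and, for an absolute constant $K$, $h(s,k)\le K\log(1+s)$ for all $s\ge0$ and all $k\ge2$. -/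

import Mathlib

open scoped BigOperators
open Filter Asymptotics

namespace MonotoneBox

/-- Discrete convexity of `g : {0, …, c} → ℝ` (only the values of `g` on `{0, …, c}` matter): for all
`x, y ∈ {0, …, c}` and `l ∈ [0, 1]`,
`l * g x + (1 - l) * g y ≥ min {g u | u ∈ {0, …, c}, |l * x + (1 - l) * y - u| ≤ 1}`.
The minimum is over a finite set, so the inequality says that some such `u` has
`g u ≤ l * g x + (1 - l) * g y`. -/
def IsDiscretelyConvex (c : ℕ) (g : ℕ → ℝ) : Prop :=
  ∀ x y : ℕ, x ≤ c → y ≤ c → ∀ l : ℝ, 0 ≤ l → l ≤ 1 →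
    ∃ u : ℕ, u ≤ c ∧ |l * (x : ℝ) + (1 - l) * (y : ℝ) - (u : ℝ)| ≤ 1 ∧
      g u ≤ l * g x + (1 - l) * g y

/-- On the integer box `{x | 0 ≤ x ≤ c}`, the function `f` is a sum of discretely convex separable
monotone functions: `f x = ∑_H a_H ∏_{j ∈ H} f_j^H (x_j)`, where `H` runs through a finite multiset
family of subsets of the coordinates (here indexed by `Fin m`, so repetitions are allowed),
`a_H > 0`, and every `f_j^H` with `j ∈ H` is non-negative, non-decreasing and discretely convex
on `{0, …, c_j}`. -/
def IsSumOfConvexSeparable {n : ℕ} (c : Fin n → ℕ) (f : (Fin n → ℕ) → ℝ) : Prop :=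
  ∃ (m : ℕ) (H : Fin m → Finset (Fin n)) (a : Fin m → ℝ) (g : Fin m → Fin n → ℕ → ℝ),
    (∀ i, 0 < a i) ∧
    (∀ i, ∀ j ∈ H i,
      (∀ z ≤ c j, 0 ≤ g i j z) ∧
      MonotoneOn (g i j) (Set.Iic (c j)) ∧
      IsDiscretelyConvex (c j) (g i j)) ∧
    ∀ x ≤ c, f x = ∑ i, a i * ∏ j ∈ H i, g i j (x j)

/-- The traction of `f` on the box `{x | 0 ≤ x ≤ c}`: the minimum positive increase of `f` when one
coordinate is raised by one inside the box. The set is finite, so the infimum is a minimum whenever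
`f` is monotone and not constant on the box. -/
noncomputable def traction {n : ℕ} (c : Fin n → ℕ) (f : (Fin n → ℕ) → ℝ) : ℝ :=
  sInf {d : ℝ | ∃ (j : Fin n) (x : Fin n → ℕ), x ≤ c ∧ x j < c j ∧
    f x < f (x + Pi.single j 1) ∧ d = f (x + Pi.single j 1) - f x}

/-- The maximal feasible vectors of the inequality `f x ≤ t` over the box `{x | 0 ≤ x ≤ c}`. -/
def maxFeasible {n : ℕ} (c : Fin n → ℕ) (f : (Fin n → ℕ) → ℝ) (t : ℝ) : Set (Fin n → ℕ) :=
  {x | x ≤ c ∧ f x ≤ t ∧ ∀ j, x j < c j → t < f (x + Pi.single j 1)}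

/-- The minimal elements of the box `{x | 0 ≤ x ≤ c}` that are not dominated by any element
of `A`. -/
def minNonDominated {n : ℕ} (c : Fin n → ℕ) (A : Set (Fin n → ℕ)) : Set (Fin n → ℕ) :=
  {x | Minimal (fun z => z ≤ c ∧ ∀ a ∈ A, ¬ z ≤ a) x}

end MonotoneBox

namespace MonotoneBox

open scoped Classical

/-! ### Weights summed over down-sets. -/

variable {n : ℕ}

/-! A product of non-negative monotone one-variable functions is a sum of non-negative weights over
the vectors below its argument, since each factor is a sum of its increments. So `f` equals
`lowerSum a` on the box with `a ≥ 0`, and counting reduces to double counting of weights.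

Let X be the intersection to be bounded, k = |Y| and s = (R - t)/τ. Vectors strictly below a member
of X lie below some y in Y. For a base point b, induct on the number of members of Y above b,
splitting the members x of X above b by the weight of the fibre {h : h ⊔ b = x}. If it is at least
ητ, x is heavy; the fibres are disjoint, and all but one lie outside a fixed down-set of value above
t, so heavy members number at most (R - t)/(ητ) + 1 (`card_heavy_le`). For light x, nearly all of f
x - f b comes from h with h ⊔ b < x; swapping sums compares these x with the y above h ⊔ b
(`card_light_le`). The induction applies there because `exists_raise` moves the base point up so
that no x but some y is lost.

With η = 1/(2k) this yields |X| ≤ 12 s k³ for s ≥ 1, while |X| ≤ 1 for s < 1 (`card_le_one`). The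
exponent is the base-k logarithm of this bound: 3 + (log 12 + log s)/log k, or 0 when s < 1. -/

/-- The sum of the weights `a h` over all `h ≤ z`. -/
noncomputable def lowerSum (a : (Fin n → ℕ) → ℝ) (z : Fin n → ℕ) : ℝ :=
  ∑ h ∈ Finset.Iic z, a h

lemma lowerSum_eq_sum_filter {a : (Fin n → ℕ) → ℝ} {c z : Fin n → ℕ} (hz : z ≤ c) :
    lowerSum a z = ∑ h ∈ (Finset.Iic c).filter (· ≤ z), a h := by
  refine Finset.sum_congr ?_ fun _ _ => rfl
  ext h
  simp only [Finset.mem_Iic, Finset.mem_filter]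
  exact ⟨fun hh => ⟨hh.trans hz, hh⟩, fun hh => hh.2⟩

lemma lowerSum_mono {a : (Fin n → ℕ) → ℝ} (ha : ∀ h, 0 ≤ a h) : Monotone (lowerSum a) :=
  fun _ _ huv => Finset.sum_le_sum_of_subset_of_nonneg (Finset.Iic_subset_Iic.2 huv)
    fun h _ _ => ha h

lemma lowerSum_sub {a : (Fin n → ℕ) → ℝ} {b z : Fin n → ℕ} (hbz : b ≤ z) :
    lowerSum a z - lowerSum a b = ∑ h ∈ (Finset.Iic z).filter (¬ · ≤ b), a h := by
  rw [lowerSum_eq_sum_filter hbz, lowerSum,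
    ← Finset.sum_filter_add_sum_filter_not (Finset.Iic z) (· ≤ b) a]
  ring

/-- The index set no longer depends on `z`, which permits swapping sums over `z` and `h`. -/
lemma lowerSum_sub_eq_sum_ite {a : (Fin n → ℕ) → ℝ} {b z c : Fin n → ℕ} (hbz : b ≤ z)
    (hz : z ≤ c) :
    lowerSum a z - lowerSum a b =
      ∑ h ∈ (Finset.Iic c).filter (¬ · ≤ b), if h ≤ z then a h else 0 := by
  rw [lowerSum_sub hbz, ← Finset.sum_filter]
  refine Finset.sum_congr ?_ fun _ _ => rfl
  ext h
  simp only [Finset.mem_Iic, Finset.mem_filter]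
  exact ⟨fun hh => ⟨⟨hh.1.trans hz, hh.2⟩, hh.1⟩, fun hh => ⟨hh.2, hh.1.2⟩⟩

/-! ### Counting in separated pairs. -/

/-- Two families `X`, `Y` in a box such that `X` lies above and `Y` below the level `t` of
`lowerSum a`, everything strictly below a member of `X` is dominated by a member of `Y`, and
`lowerSum a` has no positive increase smaller than `τ`. -/
structure IsSeparatedPair (a : (Fin n → ℕ) → ℝ) (c : Fin n → ℕ) (t τ : ℝ)
    (X Y : Finset (Fin n → ℕ)) : Prop where
  nonneg : ∀ h, 0 ≤ a h
  pos : 0 < τ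
  gap : ∀ u v, u ≤ v → v ≤ c → lowerSum a u < lowerSum a v → τ ≤ lowerSum a v - lowerSum a u
  le_left : ∀ x ∈ X, x ≤ c
  le_right : ∀ y ∈ Y, y ≤ c
  lt_left : ∀ x ∈ X, t < lowerSum a x
  right_le : ∀ y ∈ Y, lowerSum a y ≤ t
  dominated : ∀ x ∈ X, ∀ z < x, ∃ y ∈ Y, z ≤ y

namespace IsSeparatedPair

variable {a : (Fin n → ℕ) → ℝ} {c : Fin n → ℕ} {t τ : ℝ} {X Y : Finset (Fin n → ℕ)}

lemma not_left_le (H : IsSeparatedPair a c t τ X Y) {x y : Fin n → ℕ} (hx : x ∈ X) (hy : y ∈ Y) :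
    ¬ x ≤ y := fun h =>
  absurd (lowerSum_mono H.nonneg h) (not_le.2 ((H.right_le y hy).trans_lt (H.lt_left x hx)))

lemma antichain (H : IsSeparatedPair a c t τ X Y) {x x' : Fin n → ℕ} (hx : x ∈ X) (hx' : x' ∈ X)
    (h : x ≤ x') : x = x' := by
  by_contra hne
  obtain ⟨y, hy, hxy⟩ := H.dominated x' hx' x (lt_of_le_of_ne h hne)
  exact H.not_left_le hx hy hxy

/-- Since `X` is an antichain, the meet is strictly below `x`. This keeps the family in `Y`
non-empty above any base point with two members of `X` above it. -/
lemma exists_inf_le (H : IsSeparatedPair a c t τ X Y) {x x' : Fin n → ℕ} (hx : x ∈ X)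
    (hx' : x' ∈ X) (hne : x ≠ x') : ∃ y ∈ Y, x ⊓ x' ≤ y :=
  H.dominated x hx _ (lt_of_le_of_ne inf_le_left fun h =>
    hne (H.antichain hx hx' (inf_eq_left.1 h)))

/-- A base point can be raised, without losing a member of `X`, so that some member of `Y` is
lost. -/
lemma exists_raise (H : IsSeparatedPair a c t τ X Y) {b h : Fin n → ℕ} (hb : ¬ h ≤ b)
    (hne : (X.filter (h ⊔ b ≤ ·)).Nonempty) :
    ∃ b', h ⊔ b ≤ b' ∧ X.filter (b' ≤ ·) = X.filter (h ⊔ b ≤ ·) ∧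
      Y.filter (b' ≤ ·) ⊂ Y.filter (b ≤ ·) := by
  obtain ⟨j, hj⟩ : ∃ j, b j < h j := by simpa [Pi.le_def] using hb
  obtain ⟨x, hx, hmin⟩ := Finset.exists_min_image _ (fun x => x j) hne
  rw [Finset.mem_filter] at hx
  obtain ⟨hhx, hbx⟩ := sup_le_iff.1 hx.2
  have hjx : h j ≤ x j := hhx j
  -- Coordinate `j` is raised to its minimum over the members of `X` above `h ⊔ b`, so none of them
  -- is lost.
  refine ⟨Function.update (h ⊔ b) j (x j), ?_, ?_, ?_⟩
  · exact le_update_self_iff.2 (hx.2 j)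
  · refine Finset.filter_congr fun z hz => ⟨fun h' => ?_, fun h' => ?_⟩
    · exact (le_update_self_iff.2 (hx.2 j)).trans h'
    · exact update_le_iff.2 ⟨hmin z (Finset.mem_filter.2 ⟨hz, h'⟩), fun i _ => h' i⟩
  -- Lowering `x` by one at `j` stays above `b` because `b j < h j ≤ x j`. A dominating `y` has `y j
  -- < x j`, as otherwise `x ≤ y`; this `y` is the one lost.
  · obtain ⟨y, hy, hxy⟩ := H.dominated x hx.1 (Function.update x j (x j - 1))
      (update_lt_self_iff.2 (by omega))
    have hyj : y j < x j := by
      by_contra hlt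
      refine H.not_left_le hx.1 hy fun i => ?_
      by_cases hi : i = j
      · subst hi; exact not_lt.1 hlt
      · simpa [hi] using hxy i
    refine Finset.ssubset_iff_subset_ne.2 ⟨fun z hz => ?_, fun heq => ?_⟩
    · rw [Finset.mem_filter] at hz ⊢
      exact ⟨hz.1, le_sup_right.trans ((le_update_self_iff.2 (hx.2 j)).trans hz.2)⟩
    · have hmem : y ∈ Y.filter (b ≤ ·) := by
        refine Finset.mem_filter.2 ⟨hy, (le_update_iff.2 ⟨?_, fun i _ => hbx i⟩).trans hxy⟩
        omega
      rw [← heq, Finset.mem_filter] at hmem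
      have : x j ≤ y j := by simpa using hmem.2 j
      omega

/-- At most `(S c - t) / ε + 1` members `x` of `X` above `b` carry a weight of at least `ε` on
`{h | h ⊔ b = x}`. -/
lemma card_heavy_le (H : IsSeparatedPair a c t τ X Y) (htc : t ≤ lowerSum a c)
    (b : Fin n → ℕ) {ε : ℝ} (hε : 0 < ε) :
    (((X.filter (b ≤ ·)).filter
      fun x => ε ≤ ∑ h ∈ (Finset.Iic c).filter (· ⊔ b = x), a h).card : ℝ) ≤
      (lowerSum a c - t) / ε + 1 := by
  set B := (X.filter (b ≤ ·)).filter
      fun x => ε ≤ ∑ h ∈ (Finset.Iic c).filter (· ⊔ b = x), a h with hB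
  have hT : 0 ≤ (lowerSum a c - t) / ε := div_nonneg (by linarith) hε.le
  rcases B.eq_empty_or_nonempty with h0 | ⟨x₀, hx₀⟩
  · rw [h0]; simp; linarith
  have hx₀X : x₀ ∈ X ∧ b ≤ x₀ := by
    simpa using (Finset.mem_filter.1 hx₀).1
  -- By the antichain property the fibres of all heavy members other than `x₀` avoid the down-set of
  -- `x₀`; this exception is the `+ 1`.
  have key : ((B.erase x₀).card : ℝ) * ε ≤ lowerSum a c - t := by
    calc ((B.erase x₀).card : ℝ) * ε = ∑ x ∈ B.erase x₀, ε := by simp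
      _ ≤ ∑ x ∈ B.erase x₀, ∑ h ∈ (Finset.Iic c).filter (· ⊔ b = x), a h :=
          Finset.sum_le_sum fun x hx => (Finset.mem_filter.1 (Finset.mem_of_mem_erase hx)).2
      _ = ∑ h ∈ (Finset.Iic c).filter (· ⊔ b ∈ B.erase x₀), a h := by
          rw [← Finset.sum_fiberwise_of_maps_to (s := (Finset.Iic c).filter (· ⊔ b ∈ B.erase x₀))
            (t := B.erase x₀) (g := (· ⊔ b)) (fun h hh => (Finset.mem_filter.1 hh).2)]
          refine Finset.sum_congr rfl fun x hx => Finset.sum_congr ?_ fun _ _ => rfl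
          ext h
          simp only [Finset.mem_filter]
          refine ⟨fun hh => ⟨⟨hh.1, ?_⟩, hh.2⟩, fun hh => ⟨hh.1.1, hh.2⟩⟩
          rw [hh.2]; exact hx
      _ ≤ ∑ h ∈ (Finset.Iic c).filter (¬ · ≤ x₀), a h := by
          refine Finset.sum_le_sum_of_subset_of_nonneg (fun h hh => ?_) fun h _ _ => H.nonneg h
          rw [Finset.mem_filter] at hh ⊢
          refine ⟨hh.1, fun hle => ?_⟩
          have hm := Finset.mem_erase.1 hh.2
          have hmX : h ⊔ b ∈ X := by
            have := (Finset.mem_filter.1 hm.2).1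
            exact (Finset.mem_filter.1 this).1
          exact hm.1 (H.antichain hmX hx₀X.1 (sup_le hle hx₀X.2))
      _ = lowerSum a c - lowerSum a x₀ := (lowerSum_sub (H.le_left _ hx₀X.1)).symm
      _ ≤ lowerSum a c - t := by linarith [H.lt_left _ hx₀X.1]
  have hcard : (B.card : ℝ) = (B.erase x₀).card + 1 := by
    exact_mod_cast (Finset.card_erase_add_one hx₀).symm
  rw [hcard]
  have := (le_div_iff₀ hε).2 key
  linarith

/-- One step of the induction: if the families above every larger base point `h ⊔ b` are bounded
with a factor `Q`, so is, up to heavy members, the family above `b`. -/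
lemma card_light_le (H : IsSeparatedPair a c t τ X Y) {b : Fin n → ℕ}
    (hYb : (Y.filter (b ≤ ·)).Nonempty) {η Q : ℝ} (hη : 0 < η) (hη1 : η < 1)
    (hQ : ∀ h, ¬ h ≤ b → (((X.filter (b ≤ ·)).filter fun x => h ≤ x ∧ h ⊔ b ≠ x).card : ℝ) ≤
      Q * ((Y.filter (b ≤ ·)).filter (h ≤ ·)).card) (hQ0 : 0 ≤ Q) :
    (1 - η) * (((X.filter (b ≤ ·)).filter
      fun x => ¬ η * τ ≤ ∑ h ∈ (Finset.Iic c).filter (· ⊔ b = x), a h).card : ℝ) ≤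
      Q * (Y.filter (b ≤ ·)).card := by
  have hτ := H.pos
  set L := (X.filter (b ≤ ·)).filter
      fun x => ¬ η * τ ≤ ∑ h ∈ (Finset.Iic c).filter (· ⊔ b = x), a h with hL
  rcases L.eq_empty_or_nonempty with h0 | hne
  · rw [h0]; simp; positivity
  have hXL : ∀ x ∈ L, x ∈ X ∧ b ≤ x := fun x hx => by simpa using (Finset.mem_filter.1 hx).1
  obtain ⟨y₀, hy₀⟩ := hYb
  rw [Finset.mem_filter] at hy₀
  have hbt : lowerSum a b ≤ t := (lowerSum_mono H.nonneg hy₀.2).trans (H.right_le _ hy₀.1)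
  set W := (Finset.Iic c).filter (¬ · ≤ b) with hW
  -- The weights with `h ⊔ b < x`, controlled through `Y`, are separated from the fibre over `x`,
  -- which is light.
  have hsplit : ∀ x ∈ L, lowerSum a x - lowerSum a b =
      (∑ h ∈ W, if h ≤ x ∧ h ⊔ b ≠ x then a h else 0) +
        ∑ h ∈ (Finset.Iic c).filter (· ⊔ b = x), a h := by
    intro x hx
    obtain ⟨hxX, hbx⟩ := hXL x hx
    have hnb : ¬ x ≤ b := fun hxb => by
      have := lowerSum_mono H.nonneg hxb
      linarith [H.lt_left x hxX]
    have h1 : (Finset.Iic c).filter (· ⊔ b = x) = W.filter (· ⊔ b = x) := by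
      ext h
      simp only [hW, Finset.mem_filter]
      refine ⟨fun hh => ⟨⟨hh.1, fun hle => ?_⟩, hh.2⟩, fun hh => ⟨hh.1.1, hh.2⟩⟩
      rw [sup_eq_right.2 hle] at hh
      exact hnb hh.2.ge
    rw [lowerSum_sub_eq_sum_ite hbx (H.le_left x hxX), h1,
      Finset.sum_filter (s := W), ← Finset.sum_add_distrib]
    refine Finset.sum_congr rfl fun h _ => ?_
    by_cases h2 : h ⊔ b = x
    · have : h ≤ x := h2 ▸ le_sup_left
      simp [h2, this]
    · simp [h2]
  have hlight : ∀ x ∈ L, ∑ h ∈ (Finset.Iic c).filter (· ⊔ b = x), a h < η * τ := fun x hx =>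
    not_le.1 (Finset.mem_filter.1 hx).2
  -- The light fibre cannot account for the whole gap `τ` from `b` to `x`, so some `h` with positive
  -- weight has `h ⊔ b < x`. A `y` above `h ⊔ b` then exceeds `b` in value, hence by at least `τ`.
  -- Thus the loss `η * τ` is at most a fraction `η` of `t - lowerSum a b`.
  have hone : τ ≤ t - lowerSum a b := by
    obtain ⟨x, hx⟩ := hne
    obtain ⟨hxX, hbx⟩ := hXL x hx
    have hgap := H.gap b x hbx (H.le_left x hxX) (by linarith [H.lt_left x hxX])
    have hs : 0 < ∑ h ∈ W, if h ≤ x ∧ h ⊔ b ≠ x then a h else 0 := by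
      have := hsplit x hx
      have := hlight x hx
      nlinarith
    obtain ⟨h, hh, hpos⟩ := Finset.exists_lt_of_sum_lt
      (f := fun _ => (0 : ℝ)) (s := W) (by simpa using hs)
    have hcond : h ≤ x ∧ h ⊔ b ≠ x := by
      by_contra hcon
      simp [hcon] at hpos
    rw [if_pos hcond] at hpos
    obtain ⟨y, hy, hhy⟩ := H.dominated x hxX (h ⊔ b)
      (lt_of_le_of_ne (sup_le hcond.1 hbx) hcond.2)
    have hby : b ≤ y := le_sup_right.trans hhy
    have hlt : lowerSum a b < lowerSum a y := by
      have h1 := lowerSum_sub (a := a) hby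
      have h2 : a h ≤ ∑ h ∈ (Finset.Iic y).filter (¬ · ≤ b), a h :=
        Finset.single_le_sum (f := a) (fun i _ => H.nonneg i) (by
          rw [Finset.mem_filter, Finset.mem_Iic]
          exact ⟨le_sup_left.trans hhy, (Finset.mem_filter.1 hh).2⟩)
      linarith
    linarith [H.gap b y hby (H.le_right y hy) hlt, H.right_le y hy]
  have hupper : ∑ x ∈ L, (∑ h ∈ W, if h ≤ x ∧ h ⊔ b ≠ x then a h else 0) ≤
      Q * ((Y.filter (b ≤ ·)).card * (t - lowerSum a b)) := by
    calc ∑ x ∈ L, (∑ h ∈ W, if h ≤ x ∧ h ⊔ b ≠ x then a h else 0)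
        = ∑ h ∈ W, a h * (L.filter fun x => h ≤ x ∧ h ⊔ b ≠ x).card := by
          rw [Finset.sum_comm]
          refine Finset.sum_congr rfl fun h _ => ?_
          rw [← Finset.sum_filter]; simp [mul_comm]
      _ ≤ ∑ h ∈ W, a h * (Q * ((Y.filter (b ≤ ·)).filter (h ≤ ·)).card) := by
          refine Finset.sum_le_sum fun h hh => mul_le_mul_of_nonneg_left ?_ (H.nonneg h)
          refine le_trans ?_ (hQ h (Finset.mem_filter.1 hh).2)
          exact_mod_cast Finset.card_le_card (Finset.filter_subset_filter _
            (Finset.filter_subset _ _))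
      _ = Q * ∑ y ∈ Y.filter (b ≤ ·), ∑ h ∈ W, if h ≤ y then a h else 0 := by
          rw [Finset.sum_comm, Finset.mul_sum]
          refine Finset.sum_congr rfl fun h _ => ?_
          rw [← Finset.sum_filter]; simp; ring
      _ ≤ Q * ∑ y ∈ Y.filter (b ≤ ·), (t - lowerSum a b) := by
          refine mul_le_mul_of_nonneg_left (Finset.sum_le_sum fun y hy => ?_) hQ0
          rw [Finset.mem_filter] at hy
          rw [← lowerSum_sub_eq_sum_ite hy.2 (H.le_right y hy.1)]
          linarith [H.right_le y hy.1]
      _ = _ := by rw [Finset.sum_const, nsmul_eq_mul]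
  have hlower : (L.card : ℝ) * (t - lowerSum a b - η * τ) ≤
      ∑ x ∈ L, (∑ h ∈ W, if h ≤ x ∧ h ⊔ b ≠ x then a h else 0) := by
    rw [← nsmul_eq_mul, ← Finset.sum_const]
    refine Finset.sum_le_sum fun x hx => ?_
    linarith [hsplit x hx, hlight x hx, H.lt_left x (hXL x hx).1]
  set s := t - lowerSum a b
  have hs : 0 < s := by linarith
  have h1 : (L.card : ℝ) * ((1 - η) * s) ≤ L.card * (s - η * τ) :=
    mul_le_mul_of_nonneg_left (by nlinarith) (Nat.cast_nonneg _)
  refine le_of_mul_le_mul_right ?_ hs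
  calc _ = (L.card : ℝ) * ((1 - η) * s) := by ring
    _ ≤ _ := h1.trans (hlower.trans hupper)
    _ = _ := by ring

/-- The polynomial bound for the families above a base point. -/
lemma card_filter_le (H : IsSeparatedPair a c t τ X Y) (htc : t ≤ lowerSum a c) {η : ℝ}
    (hη : 0 < η) (m : ℕ) : ∀ b, (Y.filter (b ≤ ·)).card = m → 1 ≤ m → m * η < 1 →
      (1 - m * η) * ((X.filter (b ≤ ·)).card : ℝ) ≤
        ((lowerSum a c - t) / (η * τ) + 1) * (m + 1) * m := by
  induction m using Nat.strong_induction_on with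
  | _ m ih =>
  intro b hm hm1 hmη
  have hτ := H.pos
  set A := (lowerSum a c - t) / (η * τ) + 1 with hA
  have hA1 : 1 ≤ A := by
    have : 0 ≤ (lowerSum a c - t) / (η * τ) := div_nonneg (by linarith) (by positivity)
    linarith
  have hm1' : (1 : ℝ) ≤ m := by exact_mod_cast hm1
  have hη1 : η < 1 := by nlinarith
  set D := 1 - (m - 1 : ℝ) * η with hD
  have hD0 : 0 < D := by rw [hD]; nlinarith
  have hD1 : D ≤ 1 := by rw [hD]; nlinarith
  have hAD : 1 ≤ A * m / D := by
    rw [le_div_iff₀ hD0]; nlinarith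
  have hQ : ∀ h, ¬ h ≤ b → (((X.filter (b ≤ ·)).filter fun x => h ≤ x ∧ h ⊔ b ≠ x).card : ℝ) ≤
      (A * m / D) * ((Y.filter (b ≤ ·)).filter (h ≤ ·)).card := by
    intro h hb
    set N := (X.filter (b ≤ ·)).filter fun x => h ≤ x ∧ h ⊔ b ≠ x with hN
    rcases N.eq_empty_or_nonempty with h0 | ⟨x, hx⟩
    · rw [h0]; simp; positivity
    have hx' : (x ∈ X ∧ b ≤ x) ∧ h ≤ x ∧ h ⊔ b ≠ x := by simpa [hN] using hx
    have hsub : N ⊆ X.filter (h ⊔ b ≤ ·) := fun z hz => by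
      have hz' : (z ∈ X ∧ b ≤ z) ∧ h ≤ z ∧ h ⊔ b ≠ z := by simpa [hN] using hz
      exact Finset.mem_filter.2 ⟨hz'.1.1, sup_le hz'.2.1 hz'.1.2⟩
    obtain ⟨b', hb', hXb', hYb'⟩ := H.exists_raise hb ⟨x, hsub hx⟩
    have hNcard : (N.card : ℝ) ≤ (X.filter (b' ≤ ·)).card := by
      rw [hXb']; exact_mod_cast Finset.card_le_card hsub
    -- With at most one `x` above `b'` there may be no `y` above `b'`, so the induction hypothesis
    -- is unavailable; one `y` above `h ⊔ b` suffices.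
    by_cases htwo : (X.filter (b' ≤ ·)).card ≤ 1
    · obtain ⟨y, hy, hhy⟩ := H.dominated x hx'.1.1 (h ⊔ b)
        (lt_of_le_of_ne (sup_le hx'.2.1 hx'.1.2) hx'.2.2)
      have hy1 : (1 : ℝ) ≤ ((Y.filter (b ≤ ·)).filter (h ≤ ·)).card := by
        have : 0 < ((Y.filter (b ≤ ·)).filter (h ≤ ·)).card := Finset.card_pos.2 ⟨y, by
          simp only [Finset.mem_filter]
          exact ⟨⟨hy, le_sup_right.trans hhy⟩, le_sup_left.trans hhy⟩⟩
        exact_mod_cast this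
      have : ((X.filter (b' ≤ ·)).card : ℝ) ≤ 1 := by exact_mod_cast htwo
      nlinarith
    · obtain ⟨x₁, hx₁, x₂, hx₂, hne⟩ := Finset.one_lt_card.1 (not_le.1 htwo)
      rw [Finset.mem_filter] at hx₁ hx₂
      obtain ⟨y, hy, hxy⟩ := H.exists_inf_le hx₁.1 hx₂.1 hne
      have hpos : 0 < (Y.filter (b' ≤ ·)).card :=
        Finset.card_pos.2 ⟨y, Finset.mem_filter.2 ⟨hy, (le_inf hx₁.2 hx₂.2).trans hxy⟩⟩
      set m' := (Y.filter (b' ≤ ·)).card with hm'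
      have hlt : m' < m := hm ▸ Finset.card_lt_card hYb'
      have hlt' : (m' : ℝ) + 1 ≤ m := by exact_mod_cast hlt
      have hDm' : D ≤ 1 - m' * η := by rw [hD]; nlinarith
      have := ih m' hlt b' hm'.symm hpos (by linarith)
      have hle : (m' : ℝ) ≤ ((Y.filter (b ≤ ·)).filter (h ≤ ·)).card := by
        have : m' ≤ ((Y.filter (b ≤ ·)).filter (h ≤ ·)).card :=
          Finset.card_le_card fun z hz => by
            simp only [Finset.mem_filter] at hz ⊢
            exact ⟨⟨hz.1, le_sup_right.trans (hb'.trans hz.2)⟩,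
              le_sup_left.trans (hb'.trans hz.2)⟩
        exact_mod_cast this
      have h1 : D * ((X.filter (b' ≤ ·)).card : ℝ) ≤ A * m * m' :=
        (mul_le_mul_of_nonneg_right hDm' (Nat.cast_nonneg _)).trans <| this.trans <|
          mul_le_mul_of_nonneg_right (mul_le_mul_of_nonneg_left hlt' (by linarith))
            (Nat.cast_nonneg _)
      calc (N.card : ℝ) ≤ _ := hNcard
        _ ≤ A * m * m' / D := by rw [le_div_iff₀ hD0]; linarith
        _ = A * m / D * m' := by ring
        _ ≤ _ := mul_le_mul_of_nonneg_left hle (by positivity)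
  have hYb : (Y.filter (b ≤ ·)).Nonempty := Finset.card_pos.1 (by omega)
  have hlight := H.card_light_le hYb hη hη1 hQ (by positivity)
  have hheavy := H.card_heavy_le htc b (ε := η * τ) (by positivity)
  rw [← hA] at hheavy
  have hsum := Finset.card_filter_add_card_filter_not (s := X.filter (b ≤ ·))
    (fun x => η * τ ≤ ∑ h ∈ (Finset.Iic c).filter (· ⊔ b = x), a h)
  rw [← hsum, hm] at *
  push_cast
  set u : ℝ := (((X.filter (b ≤ ·)).filter
      fun x => η * τ ≤ ∑ h ∈ (Finset.Iic c).filter (· ⊔ b = x), a h).card : ℝ)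
  set v : ℝ := (((X.filter (b ≤ ·)).filter
      fun x => ¬ η * τ ≤ ∑ h ∈ (Finset.Iic c).filter (· ⊔ b = x), a h).card : ℝ)
  have hv0 : 0 ≤ v := Nat.cast_nonneg _
  have hu0 : 0 ≤ u := Nat.cast_nonneg _
  have hv : (1 - m * η) * v ≤ A * m * m := by
    have h1 : D * ((1 - η) * v) ≤ A * m * m := by
      calc D * ((1 - η) * v) ≤ D * (A * m / D * m) := mul_le_mul_of_nonneg_left hlight hD0.le
        _ = A * m * m := by field_simp
    -- The difference is `(m - 1) * η ^ 2`; each level of the induction costs one factor `1 - η`,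
    -- bounded linearly.
    have h2 : (1 - m * η) ≤ D * (1 - η) := by rw [hD]; nlinarith
    nlinarith
  have hu : (1 - m * η) * u ≤ A * m := by
    have : (1 - m * η) * u ≤ u := by nlinarith
    nlinarith
  nlinarith

/-- The polynomial bound for a separated pair. -/
lemma card_le (H : IsSeparatedPair a c t τ X Y) (htc : t ≤ lowerSum a c) (hY : Y.Nonempty) :
    (X.card : ℝ) ≤
      2 * (2 * Y.card * ((lowerSum a c - t) / τ) + 1) * (Y.card + 1) * Y.card := by
  have hτ := H.pos
  have hk : (1 : ℝ) ≤ Y.card := by exact_mod_cast Finset.card_pos.2 hY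
  have h0 : ∀ Z : Finset (Fin n → ℕ), Z.filter ((0 : Fin n → ℕ) ≤ ·) = Z := fun Z =>
    Finset.filter_true_of_mem fun z _ i => Nat.zero_le _
  have hη : (0 : ℝ) < 1 / (2 * Y.card) := by positivity
  have hkη : (Y.card : ℝ) * (1 / (2 * Y.card)) = 1 / 2 := by field_simp
  have := H.card_filter_le htc hη Y.card 0 (by rw [h0]) (Finset.card_pos.2 hY) (by
    rw [hkη]; norm_num)
  rw [h0, hkη] at this
  have h2 : (lowerSum a c - t) / (1 / (2 * Y.card) * τ) =
      2 * Y.card * ((lowerSum a c - t) / τ) := by field_simp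
  rw [h2] at this
  linarith

/-- If the level is less than `τ` below the maximum, there is at most one member of `X`. -/
lemma card_le_one (H : IsSeparatedPair a c t τ X Y) (hlt : lowerSum a c - t < τ) :
    X.card ≤ 1 := by
  refine Finset.card_le_one.2 fun x hx x' hx' => ?_
  by_contra hne
  -- A positive remaining increase would be at least `τ`, so every member of `X` attains the maximum
  -- and no weight lies outside its down-set. Two members then give their meet the same value, yet
  -- the meet lies below some `y`.
  have hmax : ∀ x ∈ X, lowerSum a c - lowerSum a x ≤ 0 := fun x hx => by
    by_contra hcon
    have := H.gap x c (H.le_left x hx) le_rfl (by linarith)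
    linarith [H.lt_left x hx]
  have hzero : ∀ x ∈ X, ∀ h ≤ c, ¬ h ≤ x → a h = 0 := fun x hx h hc hnx => by
    refine le_antisymm ?_ (H.nonneg h)
    refine le_trans (Finset.single_le_sum (f := a) (fun i _ => H.nonneg i) ?_)
      ((lowerSum_sub (a := a) (H.le_left x hx)).symm.trans_le (hmax x hx))
    exact Finset.mem_filter.2 ⟨Finset.mem_Iic.2 hc, hnx⟩
  obtain ⟨y, hy, hxy⟩ := H.exists_inf_le hx hx' hne
  have hle : lowerSum a x - lowerSum a (x ⊓ x') = 0 := by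
    rw [lowerSum_sub inf_le_left]
    refine Finset.sum_eq_zero fun h hh => ?_
    rw [Finset.mem_filter, Finset.mem_Iic] at hh
    exact hzero x' hx' h (hh.1.trans (H.le_left x hx)) fun h' => hh.2 (le_inf hh.1 h')
  linarith [H.lt_left x hx, H.right_le y hy, lowerSum_mono H.nonneg hxy]

end IsSeparatedPair

/-! ### Representation of `f` by non-negative weights. -/

/-- The product of non-negative monotone functions of the single coordinates is a sum of
non-negative weights over the vectors below. -/
lemma exists_lowerSum_eq_prod (c : Fin n → ℕ) (s : Finset (Fin n)) (g : Fin n → ℕ → ℝ)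
    (hg : ∀ j ∈ s, (∀ z ≤ c j, 0 ≤ g j z) ∧ MonotoneOn (g j) (Set.Iic (c j))) :
    ∃ a : (Fin n → ℕ) → ℝ, (∀ h, 0 ≤ a h) ∧
      ∀ x ≤ c, ∏ j ∈ s, g j (x j) = lowerSum a x := by
  classical
  -- Truncation at `c j` makes `G j` monotone on all of `ℕ`; the constant 1 extends the product to
  -- all coordinates.
  set G : Fin n → ℕ → ℝ := fun j z => if j ∈ s then g j (min z (c j)) else 1 with hG
  set d : Fin n → ℕ → ℝ := fun j z => if z = 0 then G j 0 else G j z - G j (z - 1) with hd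
  have hGmono : ∀ j z w, z ≤ w → G j z ≤ G j w := by
    intro j z w hzw
    by_cases hj : j ∈ s
    · simp only [hG, if_pos hj]
      exact (hg j hj).2 (Set.mem_Iic.2 (min_le_right _ _)) (Set.mem_Iic.2 (min_le_right _ _))
        (min_le_min_right _ hzw)
    · simp [hG, hj]
  have hG0 : ∀ j, 0 ≤ G j 0 := by
    intro j
    by_cases hj : j ∈ s
    · simp only [hG, if_pos hj]
      exact (hg j hj).1 _ (min_le_right _ _)
    · simp [hG, hj]
  have hd0 : ∀ j z, 0 ≤ d j z := by
    intro j z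
    by_cases hz : z = 0
    · simp only [hd, if_pos hz]; exact hG0 j
    · simp only [hd, if_neg hz]
      exact sub_nonneg.2 (hGmono j _ _ (Nat.sub_le _ _))
  have hsum : ∀ j z, ∑ i ∈ Finset.Iic z, d j i = G j z := by
    intro j z
    rw [← Nat.range_succ_eq_Iic]
    induction z with
    | zero => simp [hd]
    | succ z ih => rw [Finset.sum_range_succ, ih]; simp [hd]
  refine ⟨fun h => ∏ j, d j (h j), fun h => Finset.prod_nonneg fun j _ => hd0 j _, ?_⟩
  intro x hx
  have h1 : (Finset.Iic x : Finset (Fin n → ℕ)) = Fintype.piFinset fun j => Finset.Iic (x j) := by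
    ext h; simp [Pi.le_def]
  -- The down-set of `x` is a product of intervals, so the sum of products factors into telescoping
  -- sums.
  rw [lowerSum, h1, ← Finset.prod_univ_sum (fun j => Finset.Iic (x j)) d]
  simp only [hsum]
  rw [← Finset.prod_subset (Finset.subset_univ s) fun j _ hj => by simp [hG, hj]]
  exact Finset.prod_congr rfl fun j hj => by simp [hG, hj, min_eq_left (hx j)]

lemma IsSumOfConvexSeparable.exists_lowerSum {c : Fin n → ℕ} {f : (Fin n → ℕ) → ℝ}
    (hf : IsSumOfConvexSeparable c f) :
    ∃ a : (Fin n → ℕ) → ℝ, (∀ h, 0 ≤ a h) ∧ ∀ x ≤ c, f x = lowerSum a x := by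
  obtain ⟨m, H, w, g, hw, hg, hfx⟩ := hf
  choose a ha hprod using fun i => exists_lowerSum_eq_prod c (H i) (g i)
    fun j hj => ⟨(hg i j hj).1, (hg i j hj).2.1⟩
  refine ⟨fun h => ∑ i, w i * a i h, fun h => Finset.sum_nonneg fun i _ =>
    mul_nonneg (hw i).le (ha i h), fun x hx => ?_⟩
  rw [hfx x hx, lowerSum, Finset.sum_comm]
  refine Finset.sum_congr rfl fun i _ => ?_
  rw [hprod i x hx, lowerSum, Finset.mul_sum]

/-! ### Traction as a lower bound for every positive increase. -/

lemma add_single_le {x c : Fin n → ℕ} {j : Fin n} (hx : x ≤ c) (hj : x j < c j) :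
    x + Pi.single j 1 ≤ c := fun i => by
  by_cases hi : i = j
  · subst hi; simpa using hj
  · simpa [hi] using hx i

/-- The set of positive unit increments of `f` inside the box. -/
def positiveIncrements (c : Fin n → ℕ) (f : (Fin n → ℕ) → ℝ) : Set ℝ :=
  {d : ℝ | ∃ (j : Fin n) (x : Fin n → ℕ), x ≤ c ∧ x j < c j ∧
    f x < f (x + Pi.single j 1) ∧ d = f (x + Pi.single j 1) - f x}

lemma finite_positiveIncrements (c : Fin n → ℕ) (f : (Fin n → ℕ) → ℝ) :
    (positiveIncrements c f).Finite := by
  refine ((Set.finite_univ.prod (Set.finite_Iic c)).image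
    fun p : Fin n × (Fin n → ℕ) => f (p.2 + Pi.single p.1 1) - f p.2).subset ?_
  rintro d ⟨j, x, hx, -, -, rfl⟩
  exact ⟨(j, x), ⟨Set.mem_univ _, hx⟩, rfl⟩

lemma traction_pos {c : Fin n → ℕ} {f : (Fin n → ℕ) → ℝ}
    (h : (positiveIncrements c f).Nonempty) : 0 < traction c f := by
  obtain ⟨j, x, -, -, hlt, hd⟩ := h.csInf_mem (finite_positiveIncrements c f)
  change 0 < sInf (positiveIncrements c f)
  linarith

/-- A monotone function that increases between two points of the box increases by a positive unit
increment on the way. -/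
lemma exists_positiveIncrement {c : Fin n → ℕ} {f : (Fin n → ℕ) → ℝ}
    (hf : MonotoneOn f (Set.Iic c)) (k : ℕ) : ∀ u v : Fin n → ℕ, u ≤ v → v ≤ c → f u < f v →
      ∑ i, (v i - u i) = k → ∃ d ∈ positiveIncrements c f, d ≤ f v - f u := by
  induction k with
  | zero =>
    intro u v huv hvc hlt hk
    have : u = v := le_antisymm huv fun i => by
      exact Nat.sub_eq_zero_iff_le.1 (Finset.sum_eq_zero_iff.1 hk i (Finset.mem_univ i))
    exact absurd hlt (by rw [this]; exact lt_irrefl _)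
  | succ k ih =>
    intro u v huv hvc hlt hk
    obtain ⟨j, -, hj⟩ := Finset.exists_ne_zero_of_sum_ne_zero (by rw [hk]; omega)
    have hjc : u j < c j := lt_of_lt_of_le (by omega) (hvc j)
    have hu' : u + Pi.single j 1 ≤ v := add_single_le huv (by omega)
    have huc : u ≤ c := huv.trans hvc
    have hmon : f (u + Pi.single j 1) ≤ f v := hf (hu'.trans hvc) hvc hu'
    by_cases hstep : f u < f (u + Pi.single j 1)
    -- Flat steps are skipped; the first strict step is the increment sought, and monotonicity
    -- bounds it by the total.
    · exact ⟨_, ⟨j, u, huc, hjc, hstep, rfl⟩, by linarith⟩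
    · have heq : f (u + Pi.single j 1) = f u :=
        le_antisymm (not_lt.1 hstep) (hf huc (hu'.trans hvc) (le_add_of_nonneg_right
          (by intro i; exact Nat.zero_le _)))
      have hsum : ∑ i, (v i - (u + Pi.single j 1 : Fin n → ℕ) i) = k := by
        rw [← Finset.add_sum_erase _ _ (Finset.mem_univ j)] at hk ⊢
        have : ∑ i ∈ Finset.univ.erase j, (v i - (u + Pi.single j 1 : Fin n → ℕ) i) =
            ∑ i ∈ Finset.univ.erase j, (v i - u i) :=
          Finset.sum_congr rfl fun i hi => by simp [Finset.ne_of_mem_erase hi]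
        rw [this]
        simp only [Pi.add_apply, Pi.single_eq_same]
        omega
      obtain ⟨d, hd, hle⟩ := ih _ v hu' hvc (by rw [heq]; exact hlt) hsum
      exact ⟨d, hd, by rw [heq] at hle; exact hle⟩

lemma traction_le {c : Fin n → ℕ} {f : (Fin n → ℕ) → ℝ}
    (hf : MonotoneOn f (Set.Iic c)) {u v : Fin n → ℕ} (huv : u ≤ v) (hvc : v ≤ c)
    (hlt : f u < f v) : 0 < traction c f ∧ traction c f ≤ f v - f u := by
  obtain ⟨d, hd, hle⟩ := exists_positiveIncrement hf _ u v huv hvc hlt rfl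
  exact ⟨traction_pos ⟨d, hd⟩,
    (csInf_le (finite_positiveIncrements c f).bddBelow hd).trans hle⟩

/-! ### Application to maximal feasible vectors. -/

/-- Every feasible vector is dominated by a maximal feasible vector. -/
lemma exists_le_maxFeasible {c : Fin n → ℕ} {f : (Fin n → ℕ) → ℝ} {t : ℝ} {x : Fin n → ℕ}
    (hx : x ≤ c) (hft : f x ≤ t) : ∃ y ∈ maxFeasible c f t, x ≤ y := by
  have hfin : {z : Fin n → ℕ | z ≤ c ∧ f z ≤ t}.Finite :=
    (Set.finite_Iic c).subset fun z hz => hz.1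
  obtain ⟨y, hxy, hy⟩ := hfin.exists_le_maximal (a := x) ⟨hx, hft⟩
  refine ⟨y, ⟨hy.prop.1, hy.prop.2, fun j hj => ?_⟩, hxy⟩
  by_contra hcon
  have hle : y + Pi.single j 1 ≤ y :=
    hy.le_of_ge ⟨add_single_le hy.prop.1 hj, not_lt.1 hcon⟩
      (le_add_of_nonneg_right (by intro i; exact Nat.zero_le _))
  have := hle j
  simp at this

lemma mem_minNonDominated {c x : Fin n → ℕ} {A : Set (Fin n → ℕ)} :
    x ∈ minNonDominated c A ↔ Minimal (fun z => z ≤ c ∧ ∀ a ∈ A, ¬ z ≤ a) x := Iff.rfl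

lemma le_of_mem_minNonDominated {c x : Fin n → ℕ} {A : Set (Fin n → ℕ)}
    (hx : x ∈ minNonDominated c A) : x ≤ c :=
  (mem_minNonDominated.1 hx).prop.1

lemma lt_of_mem_minNonDominated {c : Fin n → ℕ} {f : (Fin n → ℕ) → ℝ} {t : ℝ} {x : Fin n → ℕ}
    (hx : x ∈ minNonDominated c (maxFeasible c f t)) : t < f x := by
  by_contra hcon
  obtain ⟨y, hy, hxy⟩ := exists_le_maxFeasible (le_of_mem_minNonDominated hx) (not_lt.1 hcon)
  exact (mem_minNonDominated.1 hx).prop.2 y hy hxy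

lemma exists_le_of_lt_minNonDominated {c : Fin n → ℕ} {Y : Set (Fin n → ℕ)} {x z : Fin n → ℕ}
    (hx : x ∈ minNonDominated c Y) (hz : z < x) : ∃ y ∈ Y, z ≤ y := by
  by_contra! hcon
  exact absurd ((mem_minNonDominated.1 hx).le_of_le
    ⟨hz.le.trans (le_of_mem_minNonDominated hx), hcon⟩ hz.le) hz.not_ge

/-- The number of minimal non-dominated vectors is at most one if `(R - t) / τ < 1`, and bounded by
a polynomial in `(R - t) / τ` and the number of maximal feasible vectors otherwise. -/
theorem ncard_minNonDominated_inter_le {c : Fin n → ℕ} {f : (Fin n → ℕ) → ℝ} {t : ℝ}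
    (hf : IsSumOfConvexSeparable c f) (ht : t ≤ f c) {Y : Set (Fin n → ℕ)}
    (hY : Y ⊆ maxFeasible c f t) (hY0 : Y.Nonempty) :
    ((minNonDominated c Y ∩ minNonDominated c (maxFeasible c f t)).ncard : ℝ) ≤
      if (f c - t) / traction c f < 1 then 1 else
        12 * ((f c - t) / traction c f) * (Y.ncard : ℝ) ^ 3 := by
  obtain ⟨a, ha, hfa⟩ := hf.exists_lowerSum
  have hmono : MonotoneOn f (Set.Iic c) := fun u hu v hv huv => by
    rw [hfa u hu, hfa v hv]; exact lowerSum_mono ha huv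
  set X := minNonDominated c Y ∩ minNonDominated c (maxFeasible c f t) with hX
  have hYfin : Y.Finite := (Set.finite_Iic c).subset fun y hy => (hY hy).1
  have hXfin : X.Finite := (Set.finite_Iic c).subset fun x hx => le_of_mem_minNonDominated hx.1
  have hk : (1 : ℝ) ≤ Y.ncard := by exact_mod_cast (Set.ncard_pos hYfin).2 hY0
  rcases X.eq_empty_or_nonempty with h0 | ⟨x, hx⟩
  · rw [h0, Set.ncard_empty, Nat.cast_zero]
    split_ifs with hs
    · exact zero_le_one
    · have := not_lt.1 hs
      positivity
  obtain ⟨y, hy⟩ := hY0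
  -- A member of `X` forces `f` to increase, excluding the default value 0 of the infimum of an
  -- empty set.
  have hτ : 0 < traction c f := by
    have hxc := le_of_mem_minNonDominated hx.1
    have hyc := (hY hy).1
    have hlt : f y < f c := ((hY hy).2.1.trans_lt (lt_of_mem_minNonDominated hx.2)).trans_le
      (hmono hxc Set.self_mem_Iic hxc)
    exact (traction_le hmono hyc le_rfl hlt).1
  have H : IsSeparatedPair a c t (traction c f) hXfin.toFinset hYfin.toFinset :=
    { nonneg := ha
      pos := hτ
      gap := fun u v huv hvc hlt => by
        rw [← hfa u (huv.trans hvc), ← hfa v hvc] at *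
        exact (traction_le hmono huv hvc hlt).2
      le_left := fun x hx => le_of_mem_minNonDominated ((Set.Finite.mem_toFinset _).1 hx).1
      le_right := fun y hy => (hY ((Set.Finite.mem_toFinset _).1 hy)).1
      lt_left := fun x hx => by
        have hx' := (Set.Finite.mem_toFinset _).1 hx
        rw [← hfa x (le_of_mem_minNonDominated hx'.1)]
        exact lt_of_mem_minNonDominated hx'.2
      right_le := fun y hy => by
        have hy' := hY ((Set.Finite.mem_toFinset _).1 hy)
        rw [← hfa y hy'.1]
        exact hy'.2.1
      dominated := fun x hx z hz => by
        simpa using exists_le_of_lt_minNonDominated ((Set.Finite.mem_toFinset _).1 hx).1 hz }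
  have hR : lowerSum a c = f c := (hfa c le_rfl).symm
  rw [Set.ncard_eq_toFinset_card X hXfin]
  split_ifs with hs
  · rw [div_lt_one hτ, ← hR] at hs
    exact_mod_cast H.card_le_one hs
  · have hle := H.card_le (by rw [hR]; exact ht) ⟨y, (Set.Finite.mem_toFinset _).2 hy⟩
    rw [← Set.ncard_eq_toFinset_card Y hYfin, hR] at hle
    refine hle.trans ?_
    set s := (f c - t) / traction c f
    set k : ℝ := (Y.ncard : ℝ)
    have hs1 : 1 ≤ s := not_lt.1 hs
    have h1 : 2 * k * s + 1 ≤ 3 * (k * s) := by nlinarith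
    have h2 : k + 1 ≤ 2 * k := by linarith
    calc 2 * (2 * k * s + 1) * (k + 1) * k ≤ 2 * (3 * (k * s)) * (2 * k) * k := by gcongr
      _ = 12 * s * k ^ 3 := by ring

/-! ### The exponent function and its growth. -/

/-- The exponent: `0` for `s < 1`, and otherwise such that `k ^ exponent s k = 12 * s * k ^ 3`. -/
noncomputable def exponent (s : ℝ) (k : ℕ) : ℝ :=
  if s < 1 then 0 else Real.logb k (12 * s * (k : ℝ) ^ 3)

lemma exponent_eq {s : ℝ} (hs : 1 ≤ s) {k : ℕ} (hk : 2 ≤ k) :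
    exponent s k = Real.log 12 / Real.log k + Real.log s / Real.log k + 3 := by
  have hk1 : (1 : ℝ) < k := by exact_mod_cast hk
  have hlog : 0 < Real.log k := Real.log_pos hk1
  rw [exponent, if_neg (not_lt.2 hs), Real.logb, Real.log_mul (by positivity) (by positivity),
    Real.log_mul (by norm_num) (by positivity), Real.log_pow]
  field_simp
  norm_num [mul_comm]

/-- For `s < 1` the value 0 is what makes a bound vanishing at `s = 0` possible. For `s ≥ 1` the
constant part is at most 4 + 3, absorbed using `log 2 ≤ log (1 + s)`, and `1 / log k ≤ 3 / 2`. -/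
lemma exponent_le {s : ℝ} (hs : 0 ≤ s) {k : ℕ} (hk : 2 ≤ k) :
    exponent s k ≤ 12 * Real.log (1 + s) := by
  by_cases hs1 : s < 1
  · rw [exponent, if_pos hs1]
    exact mul_nonneg (by norm_num) (Real.log_nonneg (by linarith))
  have hs1 := not_lt.1 hs1
  have hl2 : 0 < Real.log 2 := Real.log_pos (by norm_num)
  have hk2 : Real.log 2 ≤ Real.log k := Real.log_le_log (by norm_num) (by exact_mod_cast hk)
  have h12 : Real.log 12 ≤ 4 * Real.log 2 := by
    rw [← Real.log_rpow (by norm_num)]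
    exact Real.log_le_log (by norm_num) (by norm_num)
  have hls : 0 ≤ Real.log s := Real.log_nonneg hs1
  have h1s : Real.log s ≤ Real.log (1 + s) := Real.log_le_log (by linarith) (by linarith)
  have h2s : Real.log 2 ≤ Real.log (1 + s) := Real.log_le_log (by norm_num) (by linarith)
  have ha : Real.log 12 / Real.log k ≤ 4 := by
    rw [div_le_iff₀ (hl2.trans_le hk2)]; linarith
  have hl2' := Real.log_two_gt_d9
  have hb : Real.log s / Real.log k ≤ 3 / 2 * Real.log s := by
    rw [div_le_iff₀ (hl2.trans_le hk2)]
    nlinarith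
  rw [exponent_eq hs1 hk]
  linarith

/-- The constant terms are negligible because `log s → ∞`, and the term `log s / log k` because `log
k → ∞`. -/
lemma exponent_isLittleO :
    (fun p : ℝ × ℕ => exponent p.1 p.2) =o[atTop ×ˢ atTop] (fun p : ℝ × ℕ => Real.log p.1) := by
  have hlog : Tendsto (fun p : ℝ × ℕ => Real.log p.1) (atTop ×ˢ atTop) atTop :=
    Real.tendsto_log_atTop.comp tendsto_fst
  have hlogk : Tendsto (fun p : ℝ × ℕ => Real.log p.2) (atTop ×ˢ atTop) atTop :=
    (Real.tendsto_log_atTop.comp tendsto_natCast_atTop_atTop).comp tendsto_snd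
  have hev : (fun p : ℝ × ℕ => Real.log 12 / Real.log p.2 + Real.log p.1 / Real.log p.2 + 3)
      =ᶠ[atTop ×ˢ atTop] fun p : ℝ × ℕ => exponent p.1 p.2 := by
    filter_upwards [(eventually_ge_atTop (1 : ℝ)).prod_mk (eventually_ge_atTop 2)] with p hp
    exact (exponent_eq hp.1 hp.2).symm
  have hconst : ∀ C : ℝ, (fun _ : ℝ × ℕ => C) =o[atTop ×ˢ atTop]
      (fun p : ℝ × ℕ => Real.log p.1) := fun C =>
    isLittleO_const_left.2 (Or.inr (tendsto_norm_atTop_atTop.comp hlog))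
  have hsmall : ∀ C : ℝ, Tendsto (fun p : ℝ × ℕ => C / Real.log p.2) (atTop ×ˢ atTop) (nhds 0) :=
    fun C => hlogk.const_div_atTop C
  refine IsLittleO.congr' (((?_ : _ =o[_] _).add ?_).add (hconst 3)) hev EventuallyEq.rfl
  · exact ((hsmall (Real.log 12)).isBigO_one ℝ).trans_isLittleO (hconst 1)
  · have h1 : (fun p : ℝ × ℕ => 1 / Real.log p.2) =o[atTop ×ˢ atTop]
        (fun _ : ℝ × ℕ => (1 : ℝ)) := (isLittleO_one_iff ℝ).2 (hsmall 1)
    have := (isBigO_refl (fun p : ℝ × ℕ => Real.log p.1) (atTop ×ˢ atTop)).mul_isLittleO h1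
    simpa [div_eq_mul_inv] using this

end MonotoneBox

/-- There is one exponent function `h s k`, for `s = (R - t) / τ` and `k = |Y|`, that serves all
dimensions, boxes, functions, thresholds and families at once. It is `o(log s)` as `s` and `k` tend
to infinity, and `O(log (1 + s))` over the whole range `s ≥ 0`, `k ≥ 2`. -/
theorem proposition5p1 :
    ∃ h : ℝ → ℕ → ℝ,
      (fun p : ℝ × ℕ => h p.1 p.2) =o[atTop ×ˢ atTop] (fun p : ℝ × ℕ => Real.log p.1) ∧
      (∃ K : ℝ, ∀ s : ℝ, 0 ≤ s → ∀ k : ℕ, 2 ≤ k → h s k ≤ K * Real.log (1 + s)) ∧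
      ∀ (n : ℕ) (c : Fin n → ℕ) (f : (Fin n → ℕ) → ℝ) (t : ℝ),
        MonotoneBox.IsSumOfConvexSeparable c f →
        t ≤ f c →
        ∀ Y : Set (Fin n → ℕ), Y ⊆ MonotoneBox.maxFeasible c f t → 2 ≤ Y.ncard →
          ((MonotoneBox.minNonDominated c Y ∩
              MonotoneBox.minNonDominated c (MonotoneBox.maxFeasible c f t)).ncard : ℝ) ≤
            (Y.ncard : ℝ) ^ h ((f c - t) / MonotoneBox.traction c f) Y.ncard := by
  refine ⟨MonotoneBox.exponent, MonotoneBox.exponent_isLittleO,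
    ⟨12, fun s hs k hk => MonotoneBox.exponent_le hs hk⟩, ?_⟩
  intro n c f t hf ht Y hY hcard
  have hk1 : (1 : ℝ) < Y.ncard := by exact_mod_cast hcard
  refine (MonotoneBox.ncard_minNonDominated_inter_le hf ht hY
    (Set.nonempty_of_ncard_ne_zero (by omega))).trans_eq ?_
  rw [MonotoneBox.exponent]
  split_ifs with hs
  · rw [Real.rpow_zero]
  · have := not_lt.1 hs
    rw [Real.rpow_logb (by linarith) hk1.ne' (by positivity)]
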